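/- All graphs are finite and simple. For a graph $G$ let $\Delta(G)$ be its maximum degree and $\chi(G)$ its chromatic number. A total coloring of $G$ assigns colors to the vertices and edges of $G$ so that adjacent vertices, distinct edges sharing an endpoint, and an edge and each of its endpoints always receive different colors; $\chi''(G)$ is the least number of colors in a total coloring of $G$. The total graph $T(G)$ has vertex set $V(G)\cup E(G)$, two elements being adjacent in $T(G)$ if they are adjacent vertices of $G$, distinct edges of $G$ with a common endpoint, or a vertex of $G$ and an edge incident with it. The Hadwiger number $\eta(H)$ of a graph $H$ is the largest $t$ such that the complete graph $K_t$ is a minor of $H$. A graph is $m$-connected if it has more than $m$ vertices and remains connected after the deletion of any set of fewer than $m$ vertices. **Corollary.** Let $k\ge 1$ be an integer and let $G$ be a $(2k-1)$-connected graph that satisfies $(k)$-TCC, that is, $\chi''(G)\le \Delta(G)+k$. Then Hadwiger's conjecture is true for $T(G)$: $$\chi(T(G))\le \eta(T(G)).$$ -/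

import Mathlib

namespace SimpleGraph

/-- The total graph `T(G)`: its vertices are the vertices and the edges of `G`; two of them are
adjacent if they are adjacent vertices, distinct edges sharing an endpoint, or a vertex and an edge
incident with it. -/
def totalGraph {V : Type*} (G : SimpleGraph V) : SimpleGraph (V ⊕ G.edgeSet) where
  Adj
    | .inl u, .inl v => G.Adj u v
    | .inl v, .inr e => v ∈ (e : Sym2 V)
    | .inr e, .inl v => v ∈ (e : Sym2 V)
    | .inr e, .inr f => G.lineGraph.Adj e f
  symm := ⟨by
    rintro (u | e) (v | f) h
    · exact G.adj_symm h
    · exact h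
    · exact h
    · exact G.lineGraph.adj_symm h⟩
  loopless := ⟨by
    rintro (u | e) h
    · exact G.irrefl h
    · exact G.lineGraph.irrefl h⟩

/-- A total coloring of `G`: a proper coloring of the vertices together with a proper coloring of
the edges (a proper coloring of the line graph), such that no edge has the color of one of its
endpoints. -/
structure TotalColoring {V : Type*} (G : SimpleGraph V) (α : Type*) where
  vertexColor : G.Coloring α
  edgeColor : G.lineGraph.Coloring α
  incident_ne : ∀ (v : V) (e : G.edgeSet), v ∈ (e : Sym2 V) → vertexColor v ≠ edgeColor e

/-- The total chromatic number `χ''(G)`: the least number of colors in a total coloring of `G`. -/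
noncomputable def totalChromaticNumber {V : Type*} (G : SimpleGraph V) : ℕ∞ :=
  ⨅ (n : ℕ) (_ : Nonempty (G.TotalColoring (Fin n))), (n : ℕ∞)

/-- `G` satisfies `(k)`-TCC: `χ''(G) ≤ Δ(G) + k`. -/
def SatisfiesTCC {V : Type*} [Fintype V] (G : SimpleGraph V) [DecidableRel G.Adj] (k : ℕ) : Prop :=
  G.totalChromaticNumber ≤ (G.maxDegree + k : ℕ)

/-- `G` is (vertex-)`k`-connected: it has more than `k` vertices, and it remains connected after
the deletion of any set of fewer than `k` vertices. -/
def IsVertexConnected {V : Type*} [Fintype V] (G : SimpleGraph V) (k : ℕ) : Prop :=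
  k < Fintype.card V ∧
    ∀ X : Finset V, X.card < k → (G.induce ((X : Set V)ᶜ)).Connected

/-- `H` is a minor of `G`: there are pairwise disjoint connected (in particular non-empty) branch
sets in `G`, one for each vertex of `H`, such that the branch sets of adjacent vertices of `H` are
joined by an edge of `G`. -/
def IsMinor {W V : Type*} (H : SimpleGraph W) (G : SimpleGraph V) : Prop :=
  ∃ B : W → Set V,
    (∀ w, (G.induce (B w)).Connected) ∧
    (∀ w w', w ≠ w' → Disjoint (B w) (B w')) ∧
    ∀ w w', H.Adj w w' → ∃ x ∈ B w, ∃ y ∈ B w', G.Adj x y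

/-- The Hadwiger number `η(G)`: the number of vertices of a largest clique minor of `G`. -/
noncomputable def hadwigerNumber {V : Type*} (G : SimpleGraph V) : ℕ∞ :=
  ⨆ (t : ℕ) (_ : (completeGraph (Fin t)).IsMinor G), (t : ℕ∞)

end SimpleGraph

/-! Since χ(T(G)) ≤ χ''(G) ≤ Δ + k, a clique minor of order Δ + k in T(G) suffices. Put m = k - 1
and let v have maximum degree. Then G - v is 2m-connected, hence 2m-edge-connected (Whitney), hence
contains m edge-disjoint connected spanning subgraphs (Nash-Williams–Tutte). The branch sets are
V(G), each of the Δ edges at v, and the edge set of each subgraph: Δ + 1 + m in all. They touch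
because edges at v share v, the edge vw meets every subgraph at w, and any two subgraphs meet at
every vertex other than v.

The packing theorem comes from matroid union for the graphic matroid over the field with two
elements (`exists_linearIndepOn_fibers_spanning`), followed by a double count over the components of
the set S it provides. -/

/-! ### Matroid union for vectors -/

/-- A form of the matroid union theorem for vector families: a partial coloring of a finite
family of vectors with independent color classes, together with a set `S` that contains all
uncolored indices and is spanned by the part of each color class inside it. -/
theorem exists_linearIndepOn_fibers_spanning {K W E ι : Type*} [Field K] [AddCommGroup W]
    [Module K W] [Finite E] [Finite ι] (φ : E → W) :
    ∃ (c : E → Option ι) (S : Set E),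
      (∀ i, LinearIndepOn K φ (c ⁻¹' {some i})) ∧ (∀ e, c e = none → e ∈ S) ∧
      ∀ e ∈ S, ∀ i, φ e ∈ Submodule.span K (φ '' (c ⁻¹' {some i} ∩ S)) := by
  classical
  let Valid : Set (E → Option ι) := {c | ∀ i, LinearIndepOn K φ (c ⁻¹' {some i})}
  let unc : (E → Option ι) → ℕ := fun c => (c ⁻¹' {none}).ncard
  let Opt : (E → Option ι) → Prop := fun c => c ∈ Valid ∧ ∀ c' ∈ Valid, unc c ≤ unc c'
  obtain ⟨c₀, hv₀, hmin₀⟩ := Set.exists_min_image Valid unc (Set.toFinite _)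
    ⟨fun _ => none, fun i => by
      have : (fun _ : E => (none : Option ι)) ⁻¹' {some i} = ∅ := by ext; simp
      rw [this]; exact linearIndepOn_empty K φ⟩
  have hopt₀ : Opt c₀ := ⟨hv₀, hmin₀⟩
  -- An exchange gives f's color to the uncolored e. S collects everything left uncolored by some
  -- optimal coloring reachable from `c₀`.
  let Step : (E → Option ι) → (E → Option ι) → Prop := fun c c' =>
    Opt c' ∧ ∃ e f i, c e = none ∧ c f = some i ∧
      c' = Function.update (Function.update c f none) e (some i)
  let S : Set E := {e | ∃ c, Relation.ReflTransGen Step c₀ c ∧ c e = none}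
  have key : ∀ c, Opt c → Relation.ReflTransGen Step c₀ c → ∀ e, c e = none → ∀ i,
      φ e ∈ Submodule.span K (φ '' (c ⁻¹' {some i} ∩ S)) := by
    intro c hc hreach e he i
    -- Otherwise e could be colored i, contradicting optimality.
    have h1 : φ e ∈ Submodule.span K (φ '' (c ⁻¹' {some i})) := by
      by_contra h
      have hval : Function.update c e (some i) ∈ Valid := by
        intro j
        by_cases hj : j = i
        · subst hj
          have : Function.update c e (some j) ⁻¹' {some j} = insert e (c ⁻¹' {some j}) := by
            ext x; by_cases hx : x = e <;> simp [hx]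
          rw [this]
          exact (hc.1 j).insert h
        · have : Function.update c e (some i) ⁻¹' {some j} = c ⁻¹' {some j} := by
            ext x; by_cases hx : x = e <;> simp [hx, he, Ne.symm hj]
          rw [this]
          exact hc.1 j
      have hlt : unc (Function.update c e (some i)) < unc c := by
        apply Set.ncard_lt_ncard _ (Set.toFinite _)
        refine ⟨fun x hx => ?_, fun hh => ?_⟩
        · by_cases hxe : x = e <;> simp_all
        · have := hh (show e ∈ c ⁻¹' {none} from he)
          simp at this
      exact absurd (hc.2 _ hval) (not_le.2 hlt)
    have hswap : ∀ f, c f = some i → φ e ∉ Submodule.span K (φ '' (c ⁻¹' {some i} \ {f})) →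
        f ∈ S := by
      intro f hf h
      have hef : f ≠ e := by rintro rfl; simp [he] at hf
      refine ⟨Function.update (Function.update c f none) e (some i), hreach.tail
        ⟨⟨?_, ?_⟩, e, f, i, he, hf, rfl⟩, by simp [hef]⟩
      · intro j
        by_cases hj : j = i
        · subst hj
          have : Function.update (Function.update c f none) e (some j) ⁻¹' {some j} =
              insert e (c ⁻¹' {some j} \ {f}) := by
            ext x; by_cases hx : x = e <;> by_cases hx' : x = f <;>
              simp [Function.update_apply, hx, hx']
          rw [this]
          exact ((hc.1 j).mono Set.sdiff_subset).insert h
        · refine (hc.1 j).mono fun x hx => ?_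
          by_cases hx1 : x = e <;> by_cases hx2 : x = f <;>
            simp_all [Ne.symm hj]
      · intro c' hc'
        refine le_trans (le_of_eq ?_) (hc.2 c' hc')
        have : Function.update (Function.update c f none) e (some i) ⁻¹' {none} =
            insert f (c ⁻¹' {none} \ {e}) := by
          ext x; by_cases hx : x = e <;> by_cases hx' : x = f <;>
            simp_all
        change Set.ncard _ = Set.ncard _
        rw [this, Set.ncard_insert_of_notMem (by simp [hf]) (Set.toFinite _)]
        exact Set.ncard_sdiff_singleton_add_one he (Set.toFinite _)
    -- Every f with nonzero coefficient lies on the fundamental circuit of e, so it can be exchanged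
    -- for e and belongs to S.
    obtain ⟨l, hl, hle⟩ := (Finsupp.mem_span_image_iff_linearCombination K).1 h1
    rw [Finsupp.mem_supported] at hl
    rw [← hle, Finsupp.linearCombination_apply]
    refine Submodule.sum_mem _ fun f hf => Submodule.smul_mem _ _ (Submodule.subset_span
      ⟨f, ⟨hl hf, hswap f (hl hf) fun hcon => ?_⟩, rfl⟩)
    have hlf : l f ≠ 0 := Finsupp.mem_support_iff.1 hf
    have hsum : l f • φ f = φ e - Finsupp.linearCombination K φ (l.erase f) := by
      rw [← hle, eq_sub_iff_add_eq, ← Finsupp.linearCombination_single, ← map_add,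
        Finsupp.single_add_erase]
    have hrest : Finsupp.linearCombination K φ (l.erase f) ∈
        Submodule.span K (φ '' (c ⁻¹' {some i} \ {f})) := by
      refine (Finsupp.mem_span_image_iff_linearCombination K).2 ⟨_, ?_, rfl⟩
      rw [Finsupp.mem_supported, Finsupp.support_erase]
      intro x hx
      simp only [Finset.coe_erase, Set.mem_sdiff, Set.mem_singleton_iff] at hx
      exact ⟨hl hx.1, hx.2⟩
    have hmem : φ f ∈ Submodule.span K (φ '' (c ⁻¹' {some i} \ {f})) := by
      rw [← Submodule.smul_mem_iff _ hlf, hsum]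
      exact Submodule.sub_mem _ hcon hrest
    exact (hc.1 i).notMem_span (hl hf) hmem
  -- An exchange preserves these spans: `key` before it puts e in the old span, `key` after it puts
  -- f in the new one. Hence what holds for a reachable coloring carries back to `c₀`.
  have hinv : ∀ c, Relation.ReflTransGen Step c₀ c → Opt c ∧ ∀ i,
      Submodule.span K (φ '' (c ⁻¹' {some i} ∩ S)) =
        Submodule.span K (φ '' (c₀ ⁻¹' {some i} ∩ S)) := by
    intro c hc
    induction hc with
    | refl => exact ⟨hopt₀, fun _ => rfl⟩
    | @tail c c' hc hstep ih =>
      have hc' := hc.tail hstep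
      obtain ⟨hopt', e, f, j, he, hf, heq⟩ := hstep
      refine ⟨hopt', fun i => (le_antisymm ?_ ?_).trans (ih.2 i)⟩ <;>
        rw [Submodule.span_le] <;> rintro _ ⟨x, ⟨hx, hxS⟩, rfl⟩
      · by_cases hxe : x = e
        · subst hxe; exact key c ih.1 hc x he i
        · refine Submodule.subset_span ⟨x, ⟨?_, hxS⟩, rfl⟩
          by_cases hxf : x = f <;> simp_all [Function.update_apply]
      · by_cases hxf : x = f
        · subst hxf
          refine key c' hopt' hc' x ?_ i
          have : x ≠ e := by rintro rfl; simp [he] at hf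
          simp [heq, this]
        · refine Submodule.subset_span ⟨x, ⟨?_, hxS⟩, rfl⟩
          have : x ≠ e := by rintro rfl; simp [he] at hx
          simpa [heq, Function.update_apply, this, hxf] using hx
  refine ⟨c₀, S, hv₀, fun e he => ⟨c₀, .refl, he⟩, ?_⟩
  rintro e ⟨c, hc, he⟩ i
  rw [← (hinv c hc).2 i]
  exact key c (hinv c hc).1 hc e he i

/-! ### The graphic matroid over the field with two elements -/

namespace SimpleGraph

/-- The incidence vector of an unordered pair over the field with two elements. -/
def pairVector {V : Type*} [DecidableEq V] : Sym2 V → V → ZMod 2 :=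
  Sym2.lift ⟨fun x y => Pi.single x 1 + Pi.single y 1, fun _ _ => add_comm _ _⟩

lemma pairVector_mk {V : Type*} [DecidableEq V] (x y : V) :
    pairVector s(x, y) = Pi.single x 1 + Pi.single y 1 := rfl

lemma sum_mul_pairVector {V : Type*} [Fintype V] [DecidableEq V] (f : V → ZMod 2) (x y : V) :
    ∑ w, f w * pairVector s(x, y) w = f x + f y := by
  simp [pairVector_mk, mul_add, Finset.sum_add_distrib, Pi.single_apply]

/-- The indicator of the component of x, as a functional, kills every vector of A, hence also x + y;
so y lies in that component. -/
lemma reachable_fromEdgeSet_of_pairVector_mem_span {V : Type*} [Fintype V] [DecidableEq V]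
    {A : Set (Sym2 V)} {x y : V}
    (h : pairVector s(x, y) ∈ Submodule.span (ZMod 2) (pairVector '' A)) :
    (fromEdgeSet A).Reachable x y := by
  classical
  let f : V → ZMod 2 := fun w => if (fromEdgeSet A).Reachable x w then 1 else 0
  let L : (V → ZMod 2) →ₗ[ZMod 2] ZMod 2 := Fintype.linearCombination (ZMod 2) f
  have hL : ∀ a b, L (pairVector s(a, b)) = f a + f b := fun a b => by
    rw [← sum_mul_pairVector]
    simp [L, Fintype.linearCombination_apply, mul_comm]
  have hle : Submodule.span (ZMod 2) (pairVector '' A) ≤ LinearMap.ker L := by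
    rw [Submodule.span_le]
    rintro _ ⟨e, he, rfl⟩
    induction e with | _ a b
    have hab : f a = f b := by
      by_cases hne : a = b
      · rw [hne]
      have hadj : (fromEdgeSet A).Adj a b := (fromEdgeSet_adj A).2 ⟨he, hne⟩
      have : (fromEdgeSet A).Reachable x a ↔ (fromEdgeSet A).Reachable x b :=
        ⟨fun h => h.trans hadj.reachable, fun h => h.trans hadj.symm.reachable⟩
      simp only [f, this]
    simp only [SetLike.mem_coe, LinearMap.mem_ker, hL, hab]
    exact CharTwo.add_self_eq_zero _
  have hxy := hle h
  rw [LinearMap.mem_ker, hL] at hxy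
  by_contra hcon
  simp [f, hcon] at hxy

/-- Modulo the span of A, basis vectors of one component coincide, so the quotient has dimension at
most the number of components. -/
lemma card_le_ncard_add_card_connectedComponent {V : Type*} [Finite V] (A : Set (Sym2 V)) :
    Nat.card V ≤ A.ncard + Nat.card (fromEdgeSet A).ConnectedComponent := by
  classical
  have := Fintype.ofFinite V
  have := Fintype.ofFinite (fromEdgeSet A).ConnectedComponent
  have := Fintype.ofFinite A
  let N := Submodule.span (ZMod 2) (pairVector '' A)
  have hN : Module.finrank (ZMod 2) N ≤ A.ncard := by
    refine (finrank_span_le_card _).trans ?_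
    rw [← Set.ncard_eq_toFinset_card']
    exact Set.ncard_image_le (Set.toFinite _)
  have hstep : ∀ x y, (fromEdgeSet A).Reachable x y →
      N.mkQ (Pi.single x 1) = N.mkQ (Pi.single y 1) := by
    intro x y hxy
    rw [reachable_iff_reflTransGen] at hxy
    induction hxy with
    | refl => rfl
    | @tail a b _ hab ih =>
      rw [ih]
      refine (Submodule.Quotient.eq N).2 (Submodule.subset_span
        ⟨s(a, b), ((fromEdgeSet_adj A).1 hab).1, ?_⟩)
      rw [pairVector_mk, sub_eq_add_neg, ZModModule.neg_eq_self]
  let g : (fromEdgeSet A).ConnectedComponent → (V → ZMod 2) ⧸ N :=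
    fun C => N.mkQ (Pi.single C.out 1)
  have hg : Submodule.span (ZMod 2) (Set.range g) = ⊤ := by
    rw [eq_top_iff, ← N.range_mkQ, LinearMap.range_eq_map,
      ← (Pi.basisFun (ZMod 2) V).span_eq, Submodule.map_span, Submodule.span_le]
    rintro _ ⟨_, ⟨x, rfl⟩, rfl⟩
    refine Submodule.subset_span ⟨(fromEdgeSet A).connectedComponentMk x, ?_⟩
    rw [Pi.basisFun_apply]
    exact hstep _ _ (ConnectedComponent.exact (Quot.out_eq _))
  have hq : Module.finrank (ZMod 2) ((V → ZMod 2) ⧸ N) ≤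
      Nat.card (fromEdgeSet A).ConnectedComponent := by
    rw [← finrank_top, ← hg, Nat.card_eq_fintype_card]
    exact finrank_range_le_card g
  have := N.finrank_quotient_add_finrank
  rw [Module.finrank_fintype_fun_eq_card] at this
  rw [Nat.card_eq_fintype_card]
  omega

/-- All incidence vectors lie in the hyperplane where the coordinates sum to zero. -/
lemma ncard_lt_card_of_linearIndepOn_pairVector {V E : Type*} [Fintype V] [DecidableEq V]
    [Nonempty V] [Finite E] {u : E → Sym2 V} {s : Set E}
    (h : LinearIndepOn (ZMod 2) (fun e => pairVector (u e)) s) :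
    s.ncard < Nat.card V := by
  have := Fintype.ofFinite s
  let L : (V → ZMod 2) →ₗ[ZMod 2] ZMod 2 := Fintype.linearCombination (ZMod 2) 1
  have hL : ∀ e, L (pairVector e) = 0 := fun e => by
    induction e with | _ a b
    have := sum_mul_pairVector (fun _ => 1) a b
    rw [CharTwo.add_self_eq_zero] at this
    simpa [L, Fintype.linearCombination_apply] using this
  have hker : LinearMap.ker L ≠ ⊤ := fun htop => by
    have hmem : Pi.single (Classical.arbitrary V) 1 ∈ LinearMap.ker L := htop ▸ trivial
    simp [L, Fintype.linearCombination_apply, Pi.single_apply] at hmem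
  have hlt := Submodule.finrank_lt hker
  rw [Module.finrank_fintype_fun_eq_card, ← Nat.card_eq_fintype_card] at hlt
  refine lt_of_le_of_lt ?_ hlt
  have hfin := finrank_span_eq_card h
  rw [← Nat.card_eq_fintype_card] at hfin
  change Nat.card s ≤ _
  rw [← hfin]
  refine Submodule.finrank_mono ?_
  rw [Submodule.span_le]
  rintro _ ⟨e, rfl⟩
  exact hL _

/-! ### Edge-disjoint connected spanning subgraphs and edge connectivity -/

/-- The edges of `H` with exactly one endpoint in `A`. -/
def edgeCut {V : Type*} (H : SimpleGraph V) (A : Set V) : Set (Sym2 V) :=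
  {e | e ∈ H.edgeSet ∧ ∃ x ∈ A, ∃ y ∉ A, e = s(x, y)}

/-- Nash-Williams and Tutte: a `2 * m`-edge-connected graph contains `m` pairwise edge-disjoint
connected spanning subgraphs. -/
theorem exists_disjoint_connected_of_le_ncard_edgeCut {V : Type*} [Finite V] [Nonempty V]
    (H : SimpleGraph V) (m : ℕ)
    (hcut : ∀ A : Set V, A.Nonempty → Aᶜ.Nonempty → 2 * m ≤ (H.edgeCut A).ncard) :
    ∃ F : Fin m → SimpleGraph V, (∀ i, F i ≤ H) ∧ (∀ i, (F i).Connected) ∧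
      ∀ i j, i ≠ j → Disjoint (F i).edgeSet (F j).edgeSet := by
  classical
  have := Fintype.ofFinite V
  obtain ⟨c, S, hind, hnone, hspan⟩ := exists_linearIndepOn_fibers_spanning (K := ZMod 2)
    (ι := Fin m) (fun e : H.edgeSet => pairVector (e : Sym2 V))
  let fiber : Fin m → Set H.edgeSet := fun i => c ⁻¹' {some i}
  let val : H.edgeSet → Sym2 V := Subtype.val
  have hval : Function.Injective val := Subtype.val_injective
  let Q := fromEdgeSet (val '' S)
  have hreach : ∀ i x y, Q.Reachable x y →
      (fromEdgeSet (val '' (fiber i ∩ S))).Reachable x y := by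
    intro i x y hxy
    rw [reachable_iff_reflTransGen] at hxy
    induction hxy with
    | refl => rfl
    | @tail a b _ hab ih =>
      refine ih.trans ?_
      obtain ⟨⟨e, heS, he⟩, -⟩ := (fromEdgeSet_adj _).1 hab
      refine reachable_fromEdgeSet_of_pairVector_mem_span ?_
      rw [← he, Set.image_image]
      exact hspan e heS i
  refine ⟨fun i => fromEdgeSet (val '' fiber i), fun i x y hxy => ?_, fun i => ?_,
    fun i j hij => ?_⟩
  · obtain ⟨⟨e, -, he⟩, -⟩ := (fromEdgeSet_adj _).1 hxy
    exact H.mem_edgeSet.1 (he ▸ e.2)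
  · suffices hQ : Q.Preconnected from
      ⟨fun x y => (hreach i x y (hQ x y)).mono
        (fromEdgeSet_mono (Set.image_mono Set.inter_subset_left))⟩
    by_contra hQ
    have := Fintype.ofFinite Q.ConnectedComponent
    -- Let Q have C > 1 components. Each has at least 2m cut edges, all outside S, and an edge is in
    -- at most two of these cuts, so at least mC edges avoid S. All of those are colored; a class
    -- has at most |V| - 1 edges, at least |V| - C of them in S, so at most m(C - 1) edges avoid S.
    have hC : Fintype.card Q.ConnectedComponent * (2 * m) ≤ (Sᶜ.toFinset).card * 2 := by
      refine Finset.card_mul_le_card_mul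
        (fun (C : Q.ConnectedComponent) (e : H.edgeSet) => val e ∈ H.edgeCut C.supp) ?_ ?_
      · intro C _
        have hproper : (C.suppᶜ).Nonempty := by
          rw [Set.nonempty_compl]
          intro huniv
          exact hQ fun x y => C.reachable_of_mem_supp (huniv ▸ trivial) (huniv ▸ trivial)
        refine (hcut _ C.nonempty_supp hproper).trans ?_
        rw [← Finset.card_image_of_injective _ hval, ← Set.ncard_coe_finset]
        refine Set.ncard_le_ncard (fun e he => ?_) (Set.toFinite _)
        rw [Finset.coe_image]
        refine ⟨⟨e, he.1⟩, ?_, rfl⟩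
        simp only [Finset.mem_coe, Finset.mem_bipartiteAbove, Set.mem_toFinset]
        refine ⟨fun heS => ?_, he⟩
        obtain ⟨he, x, hx, y, hy, rfl⟩ := he
        have hadj : Q.Adj x y := (fromEdgeSet_adj _).2 ⟨⟨_, heS, rfl⟩, H.ne_of_adj he⟩
        exact hy (C.mem_supp_of_adj_mem_supp hx hadj)
      · rintro ⟨e, he⟩ _
        induction e with | _ a b
        refine (Finset.card_le_card (t := {Q.connectedComponentMk a, Q.connectedComponentMk b})
          fun C hC => ?_).trans Finset.card_le_two
        obtain ⟨-, -, x, hx, y, -, hxy⟩ := (Finset.mem_bipartiteBelow _).1 hC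
        rw [ConnectedComponent.mem_supp_iff] at hx
        have : x ∈ s(a, b) := by
          change s(a, b) = s(x, y) at hxy
          rw [hxy]; exact Sym2.mem_mk_left x y
        rcases Sym2.mem_iff.1 this with rfl | rfl <;> simp [hx]
    have hS : (Sᶜ.toFinset).card ≤ ∑ i, (fiber i \ S).ncard := by
      refine (Finset.card_le_card (t := Finset.univ.biUnion fun i => (fiber i \ S).toFinset)
        fun e he => ?_).trans (Finset.card_biUnion_le.trans (Finset.sum_le_sum fun i _ => ?_))
      · rw [Set.mem_toFinset] at he
        obtain ⟨i, hi⟩ := Option.ne_none_iff_exists'.1 (fun h => he (hnone e h))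
        exact Finset.mem_biUnion.2 ⟨i, Finset.mem_univ i, by simpa [fiber, hi] using he⟩
      · rw [Set.ncard_eq_toFinset_card']
    have hin : ∀ i, Nat.card V ≤ (fiber i ∩ S).ncard + Fintype.card Q.ConnectedComponent := by
      intro i
      refine (card_le_ncard_add_card_connectedComponent (val '' (fiber i ∩ S))).trans ?_
      rw [Set.ncard_image_of_injective _ hval, ← Nat.card_eq_fintype_card]
      refine Nat.add_le_add_left (Nat.card_le_card_of_surjective
        (fun C : Q.ConnectedComponent => connectedComponentMk _ C.out) fun D => ?_) _
      induction D using ConnectedComponent.ind with | _ x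
      exact ⟨Q.connectedComponentMk x, ConnectedComponent.sound
        (hreach i _ _ (ConnectedComponent.exact (Quot.out_eq (Q.connectedComponentMk x))))⟩
    have hlt : ∀ i, (fiber i ∩ S).ncard + (fiber i \ S).ncard + 1 ≤ Nat.card V := by
      intro i
      rw [Set.ncard_inter_add_ncard_sdiff_eq_ncard _ _ (Set.toFinite _)]
      exact ncard_lt_card_of_linearIndepOn_pairVector (hind i)
    have h1 := Finset.sum_le_sum fun i (_ : i ∈ Finset.univ) => hin i
    have h2 := Finset.sum_le_sum fun i (_ : i ∈ Finset.univ) => hlt i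
    simp only [Finset.sum_add_distrib, Finset.sum_const, Finset.card_univ, Fintype.card_fin,
      smul_eq_mul, mul_one] at h1 h2
    have hm : 0 < m := i.pos
    nlinarith
  · rw [Set.disjoint_left]
    intro e hi hj
    rw [edgeSet_fromEdgeSet] at hi hj
    obtain ⟨⟨f, hf, rfl⟩, -⟩ := hi
    obtain ⟨⟨g, hg, hfg⟩, -⟩ := hj
    obtain rfl := hval hfg
    exact hij (Option.some.inj (hf.symm.trans hg))

/-- Whitney's inequality: vertex connectivity is at most edge connectivity. -/
lemma le_ncard_edgeCut_of_connected_induce_compl {V : Type*} [Finite V] (H : SimpleGraph V)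
    (n : ℕ) (hn : n < Nat.card V)
    (hconn : ∀ X : Set V, X.ncard < n → (H.induce Xᶜ).Preconnected)
    {A : Set V} (hA : A.Nonempty) (hA' : Aᶜ.Nonempty) : n ≤ (H.edgeCut A).ncard := by
  classical
  by_contra! hlt
  -- If all cross pairs are adjacent, the cut has |A||Aᶜ| ≥ |V| - 1 ≥ n edges. Otherwise take a
  -- nonadjacent cross pair a, b; deleting from each cut edge an endpoint other than a and b
  -- separates them.
  by_cases hall : ∀ a ∈ A, ∀ b ∉ A, H.Adj a b
  · have hprod : (A ×ˢ Aᶜ).ncard ≤ (H.edgeCut A).ncard := by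
      refine Set.ncard_le_ncard_of_injOn (fun p => s(p.1, p.2)) ?_ ?_ (Set.toFinite _)
      · rintro ⟨a, b⟩ ⟨ha, hb⟩
        exact ⟨hall a ha b hb, a, ha, b, hb, rfl⟩
      · rintro ⟨a, b⟩ ⟨ha, hb⟩ ⟨a', b'⟩ ⟨ha', hb'⟩ h
        rcases Sym2.eq_iff.1 h with ⟨rfl, rfl⟩ | ⟨rfl, rfl⟩
        · rfl
        · exact absurd ha hb'
    rw [Set.ncard_prod] at hprod
    have hsum := Set.ncard_add_ncard_compl A
    have h1 : 0 < A.ncard := (Set.ncard_pos (Set.toFinite _)).2 hA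
    have h2 : 0 < Aᶜ.ncard := (Set.ncard_pos (Set.toFinite _)).2 hA'
    nlinarith
  · push Not at hall
    obtain ⟨a, ha, b, hb, hab⟩ := hall
    have hpick : ∀ e ∈ H.edgeCut A, ∃ z ∈ e, z ≠ a ∧ z ≠ b := by
      rintro _ ⟨hadj, x, hx, y, hy, rfl⟩
      by_cases hxa : x = a
      · refine ⟨y, Sym2.mem_mk_right x y, fun h => hy (h ▸ ha), ?_⟩
        rintro rfl
        exact hab (hxa ▸ hadj)
      · exact ⟨x, Sym2.mem_mk_left x y, hxa, fun h => hb (h ▸ hx)⟩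
    have : Nonempty V := ⟨a⟩
    choose! p hp hpa hpb using hpick
    let X := p '' H.edgeCut A
    have hX : X.ncard < n := (Set.ncard_image_le (Set.toFinite _)).trans_lt hlt
    have haX : a ∉ X := by rintro ⟨e, he, h⟩; exact hpa e he h
    have hbX : b ∉ X := by rintro ⟨e, he, h⟩; exact hpb e he h
    have hr := hconn X hX ⟨a, haX⟩ ⟨b, hbX⟩
    rw [reachable_iff_reflTransGen] at hr
    have hmem : ∀ z : ↥Xᶜ, Relation.ReflTransGen (H.induce Xᶜ).Adj ⟨a, haX⟩ z → z.1 ∈ A := by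
      intro z hz
      induction hz with
      | refl => exact ha
      | @tail y z _ hyz ih =>
        by_contra hzA
        have he : s(y.1, z.1) ∈ H.edgeCut A := ⟨hyz, y.1, ih, z.1, hzA, rfl⟩
        have hpX : p s(y.1, z.1) ∈ X := ⟨_, he, rfl⟩
        rcases Sym2.mem_iff.1 (hp _ he) with h | h
        · exact y.2 (h ▸ hpX)
        · exact z.2 (h ▸ hpX)
    exact hb (hmem _ hr)

end SimpleGraph

/-! ### Clique minors of the total graph -/

namespace SimpleGraph

lemma card_le_hadwigerNumber_of_isMinor {V ι : Type*} [Fintype ι] {G : SimpleGraph V}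
    (h : (completeGraph ι).IsMinor G) : (Fintype.card ι : ℕ∞) ≤ G.hadwigerNumber := by
  obtain ⟨B, hB, hd, ha⟩ := h
  let e := (Fintype.equivFin ι).symm
  exact le_iSup₂_of_le (f := fun (t : ℕ) (_ : (completeGraph (Fin t)).IsMinor G) => (t : ℕ∞)) _
    ⟨fun i => B (e i), fun i => hB _, fun i j hij => hd _ _ (e.injective.ne hij),
      fun i j hij => ha _ _ (e.injective.ne hij)⟩ le_rfl

lemma chromaticNumber_totalGraph_le {V : Type*} (G : SimpleGraph V) :
    G.totalGraph.chromaticNumber ≤ G.totalChromaticNumber := by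
  refine le_iInf₂ fun n ⟨c⟩ => ?_
  refine Colorable.chromaticNumber_le ⟨Coloring.mk (Sum.elim c.vertexColor c.edgeColor) ?_⟩
  rintro (u | e) (v | f) h
  · exact c.vertexColor.valid h
  · exact c.incident_ne _ _ h
  · exact (c.incident_ne _ _ h).symm
  · exact c.edgeColor.valid h

lemma connected_induce_totalGraph_range_inl {V : Type*} {G : SimpleGraph V} (h : G.Connected) :
    (G.totalGraph.induce (Set.range Sum.inl)).Connected := by
  let f : G →g G.totalGraph.induce (Set.range Sum.inl) :=
    ⟨fun v => ⟨.inl v, v, rfl⟩, fun h => h⟩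
  refine h.map f ?_
  rintro ⟨_, v, rfl⟩
  exact ⟨v, rfl⟩

lemma totalGraph_adj_inr {V : Type*} {G : SimpleGraph V} {e f : G.edgeSet} {x : V}
    (hne : (e : Sym2 V) ≠ f) (he : x ∈ (e : Sym2 V)) (hf : x ∈ (f : Sym2 V)) :
    G.totalGraph.Adj (.inr e) (.inr f) :=
  lineGraph_adj_iff_exists.2 ⟨fun h => hne (congrArg _ h), x, he, hf⟩

/-- The vertices of the total graph of `G` that are edges of `F`. -/
def totalEdges {V : Type*} (G F : SimpleGraph V) : Set (V ⊕ G.edgeSet) :=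
  {z | ∃ e : G.edgeSet, z = .inr e ∧ (e : Sym2 V) ∈ F.edgeSet}

/-- Consecutive edges of a walk in F are adjacent in the total graph. Connectivity is asked only on
the support, since the subgraphs used later miss a vertex. -/
lemma connected_induce_totalEdges {V : Type*} {G F : SimpleGraph V} (hFG : F ≤ G)
    (hne : F ≠ ⊥) (h : ∀ x ∈ F.support, ∀ y ∈ F.support, F.Reachable x y) :
    (G.totalGraph.induce (G.totalEdges F)).Connected := by
  have hmem : ∀ {e : Sym2 V} (he : e ∈ F.edgeSet),
      (.inr ⟨e, edgeSet_mono hFG he⟩ : V ⊕ G.edgeSet) ∈ G.totalEdges F :=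
    fun he => ⟨_, rfl, he⟩
  have hstep : ∀ {e f : Sym2 V} (he : e ∈ F.edgeSet) (hf : f ∈ F.edgeSet) {x : V},
      x ∈ e → x ∈ f →
      (G.totalGraph.induce (G.totalEdges F)).Reachable ⟨_, hmem he⟩ ⟨_, hmem hf⟩ := by
    intro e f he hf x hxe hxf
    by_cases hef : e = f
    · subst hef; rfl
    · exact Adj.reachable (totalGraph_adj_inr (G := G) hef hxe hxf)
  have hwalk : ∀ {x y : V}, F.Reachable x y → ∀ {e f : Sym2 V} (he : e ∈ F.edgeSet)
      (hf : f ∈ F.edgeSet), x ∈ e → y ∈ f →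
      (G.totalGraph.induce (G.totalEdges F)).Reachable ⟨_, hmem he⟩ ⟨_, hmem hf⟩ := by
    intro x y hxy
    rw [reachable_iff_reflTransGen] at hxy
    induction hxy with
    | refl => exact fun he hf hxe hxf => hstep he hf hxe hxf
    | @tail y z _ hyz ih =>
      exact fun he hf hxe hzf => (ih he hyz hxe (Sym2.mem_mk_left y z)).trans
        (hstep hyz hf (Sym2.mem_mk_right y z) hzf)
  obtain ⟨a, b, hab⟩ := ne_bot_iff_exists_adj.1 hne
  have : Nonempty (G.totalEdges F) := ⟨⟨_, hmem (F.mem_edgeSet.2 hab)⟩⟩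
  refine ⟨?_⟩
  rintro ⟨_, ⟨e, heG⟩, rfl, he⟩ ⟨_, ⟨f, hfG⟩, rfl, hf⟩
  induction e with | _ x x'
  induction f with | _ y y'
  exact hwalk (h x ⟨x', he⟩ y ⟨y', hf⟩) he hf (Sym2.mem_mk_left x x') (Sym2.mem_mk_left y y')

/-- Pairwise edge-disjoint connected subgraphs of `G` spanning all vertices except `v` give,
together with the edges at `v` and the set of all vertices, a clique minor of the total graph. -/
theorem degree_add_le_hadwigerNumber_totalGraph {V : Type*} {G : SimpleGraph V}
    (hG : G.Connected) (v : V) [Fintype (G.neighborSet v)] {m : ℕ} (F : Fin m → SimpleGraph V)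
    (hFG : ∀ i, F i ≤ G) (hsupp : ∀ i, (F i).support = {v}ᶜ)
    (hne : ∀ i, F i ≠ ⊥) (hconn : ∀ i, ∀ x ≠ v, ∀ y ≠ v, (F i).Reachable x y)
    (hdisj : ∀ i j, i ≠ j → Disjoint (F i).edgeSet (F j).edgeSet) :
    ((G.degree v + m + 1 : ℕ) : ℕ∞) ≤ G.totalGraph.hadwigerNumber := by
  have hcard : Fintype.card (Option (G.neighborSet v ⊕ Fin m)) = G.degree v + m + 1 := by
    rw [Fintype.card_option, Fintype.card_sum, Fintype.card_fin, G.card_neighborSet_eq_degree]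
  rw [← hcard]
  let star : G.neighborSet v → G.edgeSet := fun w => ⟨s(v, w), w.2⟩
  have hstar : ∀ w, v ∈ (star w : Sym2 V) := fun w => Sym2.mem_mk_left v w
  have hstar_ne : ∀ w w', w ≠ w' → (star w : Sym2 V) ≠ star w' := fun w w' h h' =>
    h (Subtype.ext (Sym2.congr_right.1 h'))
  have hvF : ∀ i, ∀ e ∈ (F i).edgeSet, v ∉ e := by
    intro i e he hv
    obtain ⟨w, rfl⟩ := Sym2.mem_iff_exists.1 hv
    have : v ∈ (F i).support := ⟨w, he⟩
    rw [hsupp] at this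
    exact this rfl
  have hedge : ∀ i, ∀ x ≠ v, ∃ e : G.edgeSet, (e : Sym2 V) ∈ (F i).edgeSet ∧
      x ∈ (e : Sym2 V) := by
    intro i x hx
    have : x ∈ (F i).support := by rw [hsupp]; exact hx
    obtain ⟨y, hxy⟩ := this
    exact ⟨⟨s(x, y), hFG i hxy⟩, hxy, Sym2.mem_mk_left x y⟩
  let B : Option (G.neighborSet v ⊕ Fin m) → Set (V ⊕ G.edgeSet)
    | none => Set.range .inl
    | some (.inl w) => {.inr (star w)}
    | some (.inr i) => G.totalEdges (F i)
  -- Both minor conditions on a pair are symmetric, so bundling them leaves one order of each pair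
  -- to check.
  let Touch : Set (V ⊕ G.edgeSet) → Set (V ⊕ G.edgeSet) → Prop := fun s t =>
    Disjoint s t ∧ ∃ x ∈ s, ∃ y ∈ t, G.totalGraph.Adj x y
  have touch_symm : ∀ {s t}, Touch s t → Touch t s := fun ⟨hd, x, hx, y, hy, h⟩ =>
    ⟨hd.symm, y, hy, x, hx, h.symm⟩
  have h01 : ∀ w, Touch (B none) (B (some (.inl w))) := fun w =>
    ⟨by simp [B], .inl v, ⟨v, rfl⟩, .inr (star w), rfl, hstar w⟩
  have h02 : ∀ i, Touch (B none) (B (some (.inr i))) := by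
    intro i
    obtain ⟨a, b, hab⟩ := ne_bot_iff_exists_adj.1 (hne i)
    refine ⟨?_, .inl a, ⟨a, rfl⟩, .inr ⟨s(a, b), hFG i hab⟩, ⟨_, rfl, hab⟩,
      Sym2.mem_mk_left a b⟩
    rw [Set.disjoint_left]
    rintro _ ⟨x, rfl⟩ ⟨e, he, -⟩
    cases he
  have h11 : ∀ w w', w ≠ w' → Touch (B (some (.inl w))) (B (some (.inl w'))) := by
    intro w w' h
    refine ⟨?_, _, rfl, _, rfl, totalGraph_adj_inr (hstar_ne w w' h) (hstar w) (hstar w')⟩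
    refine Set.disjoint_singleton.2 fun h' => hstar_ne w w' h ?_
    rw [Sum.inr.inj h']
  have h12 : ∀ w i, Touch (B (some (.inl w))) (B (some (.inr i))) := by
    intro w i
    obtain ⟨e, he, hwe⟩ := hedge i w (G.ne_of_adj w.2).symm
    refine ⟨?_, _, rfl, .inr e, ⟨e, rfl, he⟩, totalGraph_adj_inr (fun h => ?_)
      (Sym2.mem_mk_right v w) hwe⟩
    · refine Set.disjoint_singleton_left.2 ?_
      rintro ⟨f, hf, hfF⟩
      rw [← Sum.inr.inj hf] at hfF
      exact hvF i _ hfF (hstar w)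
    · exact hvF i e he (h ▸ hstar w)
  have h22 : ∀ i j, i ≠ j → Touch (B (some (.inr i))) (B (some (.inr j))) := by
    intro i j hij
    have hd := Set.disjoint_left.1 (hdisj i j hij)
    obtain ⟨a, b, hab⟩ := ne_bot_iff_exists_adj.1 (hne i)
    have hav : a ≠ v := fun h => hvF i s(a, b) hab (Sym2.mem_iff.2 (.inl h.symm))
    obtain ⟨f, hf, haf⟩ := hedge j a hav
    refine ⟨?_, .inr ⟨s(a, b), hFG i hab⟩, ⟨_, rfl, hab⟩, .inr f, ⟨f, rfl, hf⟩,
      totalGraph_adj_inr (fun h => hd hab (h ▸ hf)) (Sym2.mem_mk_left a b) haf⟩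
    rw [Set.disjoint_left]
    rintro _ ⟨e, rfl, he⟩ ⟨e', he', heF⟩
    rw [← Sum.inr.inj he'] at heF
    exact hd he heF
  have htouch : ∀ p q, p ≠ q → Touch (B p) (B q) := by
    rintro (_ | w | i) (_ | w' | j) hpq
    · exact absurd rfl hpq
    · exact h01 w'
    · exact h02 j
    · exact touch_symm (h01 w)
    · exact h11 w w' fun h => hpq (h ▸ rfl)
    · exact h12 w j
    · exact touch_symm (h02 i)
    · exact touch_symm (h12 w' i)
    · exact h22 i j fun h => hpq (h ▸ rfl)
  refine card_le_hadwigerNumber_of_isMinor ⟨B, ?_, fun p q h => (htouch p q h).1,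
    fun p q h => (htouch p q h).2⟩
  rintro (_ | w | i)
  · exact connected_induce_totalGraph_range_inl hG
  · exact (connected_top (V := ({.inr (star w)} : Set (V ⊕ G.edgeSet)))).mono
      fun x y h => absurd (Subsingleton.elim x y) h
  · refine connected_induce_totalEdges (hFG i) (hne i) fun x hx y hy => ?_
    rw [hsupp] at hx hy
    exact hconn i x hx y hy

/-! ### Packing after deleting a vertex -/

/-- After deleting a vertex from a `(2 * m + 1)`-connected graph, one can still find `m` pairwise
edge-disjoint connected subgraphs spanning the remaining vertices. -/
theorem IsVertexConnected.exists_disjoint_spanning_compl_singleton {V : Type*} [Fintype V]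
    {G : SimpleGraph V} {m : ℕ} (h : G.IsVertexConnected (2 * m + 1)) (v : V) :
    ∃ F : Fin m → SimpleGraph V, (∀ i, F i ≤ G) ∧ (∀ i, (F i).support = {v}ᶜ) ∧
      (∀ i, F i ≠ ⊥) ∧ (∀ i, ∀ x ≠ v, ∀ y ≠ v, (F i).Reachable x y) ∧
      ∀ i j, i ≠ j → Disjoint (F i).edgeSet (F j).edgeSet := by
  classical
  let U : Set V := {v}ᶜ
  have hcard : 2 * m < Nat.card U := by
    have h1 := Set.ncard_add_ncard_compl ({v} : Set V)
    rw [Set.ncard_singleton, Nat.card_eq_fintype_card] at h1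
    have h2 := h.1
    change 2 * m < Set.ncard ({v}ᶜ : Set V)
    omega
  have : Nonempty U := (Nat.card_pos_iff.1 (Nat.zero_lt_of_lt hcard)).1
  -- Deleting X from G - v is deleting X ∪ {v} from G, which costs one unit of connectivity.
  have hconn : ∀ X : Set U, X.ncard < 2 * m → ((G.induce U).induce Xᶜ).Preconnected := by
    intro X hX
    let Y : Finset V := insert v (Subtype.val '' X).toFinset
    have hY : Y.card < 2 * m + 1 := by
      refine (Finset.card_insert_le _ _).trans_lt ?_
      rw [← Set.ncard_eq_toFinset_card', Set.ncard_image_of_injective _ Subtype.val_injective]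
      omega
    have hYv : ∀ z : ↥((Y : Set V)ᶜ), z.1 ∈ U := fun z hz => z.2 (by simp [Y, show z.1 = v from hz])
    have hYX : ∀ z : ↥((Y : Set V)ᶜ), (⟨z.1, hYv z⟩ : U) ∈ Xᶜ := fun z hz => z.2 (by
      refine Finset.mem_coe.2 (Finset.mem_insert_of_mem (Set.mem_toFinset.2 ⟨_, hz, rfl⟩)))
    let f : G.induce ((Y : Set V)ᶜ) →g (G.induce U).induce Xᶜ :=
      ⟨fun z => ⟨⟨z.1, hYv z⟩, hYX z⟩, fun h => h⟩
    refine (h.2 Y hY).preconnected.map f ?_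
    rintro ⟨⟨z, hz⟩, hzX⟩
    refine ⟨⟨z, fun hzY => ?_⟩, rfl⟩
    rcases Finset.mem_insert.1 (Finset.mem_coe.1 hzY) with rfl | hzY
    · exact hz rfl
    · obtain ⟨z', hz', rfl⟩ := Set.mem_toFinset.1 hzY
      exact hzX hz'
  obtain ⟨F, hF, hFconn, hFd⟩ := exists_disjoint_connected_of_le_ncard_edgeCut (G.induce U) m
    fun A hA hA' => le_ncard_edgeCut_of_connected_induce_compl _ _ hcard hconn hA hA'
  -- An index i forces m ≥ 1, hence |U| > 2; for m = 0, U may be a single vertex.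
  have hnt : ∀ _ : Fin m, Nontrivial U := fun i => by
    have := i.pos
    rw [← Finite.one_lt_card_iff_nontrivial]
    omega
  let ι : U ↪ V := Function.Embedding.subtype _
  have hsupp : ∀ i, ∀ x : U, ∃ y, (F i).Adj x y := fun i x => by
    have := hnt i
    exact (hFconn i).preconnected.exists_adj_of_nontrivial x
  refine ⟨fun i => (F i).map ι, fun i => ?_, fun i => ?_, fun i => ?_, fun i x hx y hy => ?_,
    fun i j hij => ?_⟩
  · rw [map_le_iff_le_comap]
    exact hF i
  · ext x
    constructor
    · rintro ⟨y, hxy⟩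
      obtain ⟨a, b, -, rfl, -⟩ := ((F i).map_adj ι x y).1 hxy
      exact a.2
    · intro hx
      obtain ⟨y, hy⟩ := hsupp i ⟨x, hx⟩
      exact ⟨y, ((F i).map_adj ι _ _).2 ⟨_, _, hy, rfl, rfl⟩⟩
  · obtain ⟨y, hy⟩ := hsupp i (Classical.arbitrary U)
    exact ne_bot_iff_exists_adj.2 ⟨_, _, ((F i).map_adj ι _ _).2 ⟨_, _, hy, rfl, rfl⟩⟩
  · exact ((hFconn i).preconnected ⟨x, hx⟩ ⟨y, hy⟩).map (Embedding.map ι (F i)).toHom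
  · rw [edgeSet_map, edgeSet_map]
    exact (Set.disjoint_image_iff ι.sym2Map.injective).2 (hFd i j hij)

end SimpleGraph

/-! ### Assembly -/

theorem mainTheorem9 {V : Type*} [Fintype V] (G : SimpleGraph V) [DecidableRel G.Adj]
    (k : ℕ) (hk : 1 ≤ k)
    (hconn : G.IsVertexConnected (2 * k - 1))
    (hTCC : G.SatisfiesTCC k) :
    G.totalGraph.chromaticNumber ≤ G.totalGraph.hadwigerNumber := by
  classical
  -- With k = m + 1, 2k - 1 is 2m + 1 and Δ + k is Δ + m + 1, the order of the clique minor.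
  obtain ⟨m, rfl⟩ := Nat.exists_eq_add_of_le' hk
  have hconn' : G.IsVertexConnected (2 * m + 1) := hconn
  have : Nonempty V := Fintype.card_pos_iff.1 (Nat.zero_lt_of_lt hconn.1)
  have hG : G.Connected := by
    let f : G.induce (((∅ : Finset V) : Set V)ᶜ) →g G := ⟨Subtype.val, fun h => h⟩
    exact (hconn'.2 ∅ (by simp)).map f fun x => ⟨⟨x, by simp⟩, rfl⟩
  obtain ⟨v, hv⟩ := G.exists_maximal_degree_vertex
  obtain ⟨F, hFG, hsupp, hne, hreach, hdisj⟩ :=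
    hconn'.exists_disjoint_spanning_compl_singleton v
  refine (G.chromaticNumber_totalGraph_le.trans hTCC).trans ?_
  rw [hv, ← add_assoc]
  exact SimpleGraph.degree_add_le_hadwigerNumber_totalGraph hG v F hFG hsupp hne hreach hdisj
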